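/- Let $\mathcal H$ be a real Hilbert space and let $r\ge 1$. For a set-valued operator $A:\mathcal H\rightrightarrows\mathcal H$, let $\operatorname{ran}A=\bigcup_{x}A(x)$, let $J_A=(\operatorname{Id}+A)^{-1}$ denote its resolvent, i.e. $J_A(x)=\{y\in\mathcal H : x\in y+A(y)\}$, and for $w\in\mathcal H$ let $A_w(x)=A(x-w)$. A value of $J_A$ that is a singleton is identified with its element. The operator $A$ is maximally monotone if for all $(x,u)\in\mathcal H\times\mathcal H$: $u\in A(x)$ if and only if $\langle x-y,u-v\rangle\ge 0$ for all $y\in\mathcal H$ and $v\in A(y)$. Theorem (Parallel AAMR splitting algorithm). Let $A_1,\dots,A_r:\mathcal H\rightrightarrows\mathcal H$ be maximally monotone, let $\gamma>0$, let $\beta\in\,]0,1[$, and let $(\lambda_n)_{n\ge 0}$ be a sequence in $[0,1]$ with $\sum_{n\ge 0}\lambda_n(1-\lambda_n)=+\infty$. Suppose that $q\in\operatorname{ran}\bigl(\operatorname{Id}+\frac{\gamma}{2r(1-\beta)}\sum_{i=1}^r A_i\bigr)$. Given $x_{1,0},\dots,x_{r,0}\in\mathcal H$, for $n=0,1,2,\dots$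 set $$p_n=\frac1r\sum_{i=1}^r x_{i,n},\qquad x_{i,n+1}=(1-\lambda_n)x_{i,n}+\lambda_n\bigl(2\beta J_{\gamma (A_i)_{-q}}-\operatorname{Id}\bigr)(2\beta p_n-x_{i,n}),\quad i=1,\dots,r.$$ Then these sequences are well defined (they exist and are uniquely determined by the starting points), $J_{\frac{\gamma}{2r(1-\beta)}\sum_{i=1}^r A_i}(q)$ is a single point, and the following hold: (i) for every $i=1,\dots,r$, $(x_{i,n+1}-x_{i,n})_{n\ge 0}$ converges strongly to $0$; (ii) for every $i=1,\dots,r$, $(x_{i,n})_{n\ge 0}$ converges weakly to some $x_i^\star\in\mathcal H$, and $$q+\frac1r\sum_{i=1}^r x_i^\star=J_{\frac{\gamma}{2r(1-\beta)}\sum_{i=1}^r A_i}(q);$$ (iii) $(q+p_n)_{n\ge 0}$ converges strongly to $J_{\frac{\gamma}{2r(1-\beta)}\sum_{i=1}^r A_i}(q)$. -/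

import Mathlib

open Filter Topology
open scoped Pointwise InnerProductSpace

namespace SetValuedOp

variable {H : Type*} [NormedAddCommGroup H] [InnerProductSpace ℝ H]

/-- A set-valued operator `A : H ⇉ H` (a function `H → Set H`) is monotone. -/
def IsMonotone (A : H → Set H) : Prop :=
  ∀ x y : H, ∀ u ∈ A x, ∀ v ∈ A y, 0 ≤ ⟪x - y, u - v⟫_ℝ

/-- Maximal monotonicity: `A` is monotone, and every pair `(x, u)` that is monotonically related
to the whole graph of `A` already belongs to the graph. -/
def IsMaximallyMonotone (A : H → Set H) : Prop :=
  IsMonotone A ∧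
    ∀ x u : H, (∀ y : H, ∀ v ∈ A y, 0 ≤ ⟪x - y, u - v⟫_ℝ) → u ∈ A x

/-- The range of a set-valued operator. -/
def ran (A : H → Set H) : Set H := {u | ∃ x : H, u ∈ A x}

/-- The identity as a set-valued operator. -/
def idOp : H → Set H := fun x => {x}

/-- The inverse of a set-valued operator. -/
def inv (A : H → Set H) : H → Set H := fun x => {y | x ∈ A y}

/-- The resolvent `J_A = (Id + A)⁻¹`, a set-valued operator. Sums and multiples of operators are
pointwise Minkowski sums and multiples of sets. -/
def resolvent (A : H → Set H) : H → Set H := inv (idOp + A)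

/-- The inner `w`-perturbation `A_w : x ↦ A (x - w)`. -/
def innerPerturb (A : H → Set H) (w : H) : H → Set H := fun x => A (x - w)

/-- The modified reflected resolvent `2 β J_A - Id`, a set-valued operator. -/
def modReflResolvent (β : ℝ) (A : H → Set H) : H → Set H :=
  (2 * β) • resolvent A - idOp

/-- The average `(1/r) ∑ i, x i` of `r` points. -/
noncomputable def average {r : ℕ} (x : Fin r → H) : H := (1 / (r : ℝ)) • ∑ i, x i

/-- The sequence `x` (with `x n i` the `i`-th component of the `n`-th iterate) is generated from
the starting point `x₀` by the parallel AAMR scheme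
`x (n+1) i = (1 - λ_n) x n i + λ_n (2 β J_{γ (A_i)_{-q}} - Id) (2 β p_n - x n i)`,
where `p_n` is the average of the `x n i`. -/
def IsParallelAAMR {r : ℕ} (A : Fin r → H → Set H) (γ β : ℝ) (lam : ℕ → ℝ) (q : H)
    (x₀ : Fin r → H) (x : ℕ → Fin r → H) : Prop :=
  x 0 = x₀ ∧
    ∀ (n : ℕ) (i : Fin r),
      ∃ u ∈ modReflResolvent β (γ • innerPerturb (A i) (-q)) ((2 * β) • average (x n) - x n i),
        x (n + 1) i = (1 - lam n) • x n i + lam n • u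

end SetValuedOp

/-!
The iteration is a Krasnosel'skiĭ–Mann iteration in the Hilbert product space `H ^ r`. By Minty's
theorem the resolvents `J i` of `γ (A i)_{-q}` are defined everywhere, and by monotonicity they are
single-valued and firmly nonexpansive, so the scheme reads
`x (n + 1) = (1 - λ n) x n + λ n T (x n)`, where `T` is `aamrMap`: the composition of
`2 β P - Id`, with `P` the projection onto the diagonal (averaging), and of the maps
`2 β J i - Id` acting coordinatewise. Firm nonexpansiveness gives the key estimate
`norm_aamrMap_sub_sq_le`,
`‖T x - T y‖² + 4 β (1 - β) r ‖average x - average y‖² ≤ ‖x - y‖²`.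

A point `x` is fixed by `T` exactly when every `J i` maps `2 β p - x i` to `p`, the average of `x`.
Adding these `r` inclusions shows that `q + p` is the resolvent of the scaled sum at `q`
(`sub_mem_of_aamrMap_eq_self`); conversely, the range condition on `q` produces a fixed point
(`exists_aamrMap_eq_self`).

As `T` is nonexpansive with a fixed point, `krasnoselskii_mann` yields `x n - T (x n) → 0`, hence
vanishing increments, and weak convergence of `x n` to a fixed point. The second term of the key
estimate, applied with `y` a fixed point, is bounded by a multiple of `‖x n - T (x n)‖`; this makes
the averages converge strongly (`tendsto_average_of_tendsto_residual`).

Minty's theorem is obtained by minimising the Fitzpatrick function plus half the squared norm over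
`H × H` (`exists_neg_mem`). Opial's lemma for nonexpansive maps works with ultrafilters instead of
subsequences, so that the Banach–Alaoglu theorem applies without separability.
-/

/-! ### Minty's theorem -/

/-- On a closed convex set of pairs `(x, t)`, such as the epigraph of a convex function, the
objective `t + ‖x‖² / 2` attains its infimum if bounded below, and it grows at least quadratically
away from the minimiser. -/
theorem exists_forall_add_half_norm_sq_le {K : Type*} [NormedAddCommGroup K]
    [InnerProductSpace ℝ K] [CompleteSpace K] {E : Set (K × ℝ)} (hconv : Convex ℝ E)
    (hclosed : IsClosed E) (hne : E.Nonempty) (m₀ : ℝ)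
    (hbdd : ∀ w ∈ E, m₀ ≤ w.2 + ‖w.1‖ ^ 2 / 2) :
    ∃ w ∈ E, ∀ w' ∈ E,
      w.2 + ‖w.1‖ ^ 2 / 2 + ‖w'.1 - w.1‖ ^ 2 / 2 ≤ w'.2 + ‖w'.1‖ ^ 2 / 2 := by
  set φ : K × ℝ → ℝ := fun w => w.2 + ‖w.1‖ ^ 2 / 2 with hφ
  have hbelow : BddBelow (φ '' E) := ⟨m₀, by rintro _ ⟨w, hw, rfl⟩; exact hbdd w hw⟩
  set m := sInf (φ '' E) with hm
  have hmle : ∀ w ∈ E, m ≤ φ w := fun w hw => csInf_le hbelow ⟨w, hw, rfl⟩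
  -- Strong convexity: `φ` lies below its chords by a quadratic term.
  have hchord : ∀ a ∈ E, ∀ b ∈ E, ∀ s : ℝ, 0 ≤ s → s ≤ 1 →
      m ≤ (1 - s) * φ a + s * φ b - s * (1 - s) / 2 * ‖b.1 - a.1‖ ^ 2 := by
    intro a ha b hb s hs hs'
    refine (hmle _ (hconv ha hb (sub_nonneg.2 hs') hs (by ring))).trans (le_of_eq ?_)
    simp only [hφ, Prod.fst_add, Prod.snd_add, Prod.smul_fst, Prod.smul_snd, smul_eq_mul]
    rw [norm_add_sq_real, norm_sub_sq_real, norm_smul, norm_smul, real_inner_smul_left,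
      real_inner_smul_right, mul_pow, mul_pow, Real.norm_eq_abs, Real.norm_eq_abs, sq_abs, sq_abs,
      real_inner_comm b.1 a.1]
    ring
  obtain ⟨f, -, hftends, hfmem⟩ := exists_seq_tendsto_sInf (hne.image φ) hbelow
  choose w hwE hwf using hfmem
  have hφw : Tendsto (fun n => φ (w n)) atTop (𝓝 m) := by simpa only [hwf] using hftends
  -- The chord inequality at the midpoint makes every minimising sequence Cauchy.
  have hcauchy : CauchySeq fun n => (w n).1 := by
    rw [Metric.cauchySeq_iff']
    intro ε hε
    obtain ⟨N, hN⟩ := eventually_atTop.1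
      (hφw.eventually (gt_mem_nhds (lt_add_of_pos_right m (show 0 < ε ^ 2 / 8 by positivity))))
    refine ⟨N, fun n hn => ?_⟩
    have h := hchord _ (hwE N) _ (hwE n) (1 / 2) (by norm_num) (by norm_num)
    have h1 := hN n hn
    have h2 := hN N le_rfl
    rw [dist_eq_norm]
    refine lt_of_pow_lt_pow_left₀ 2 hε.le ?_
    linarith
  obtain ⟨x, hx⟩ := cauchySeq_tendsto_of_complete hcauchy
  have ht : Tendsto (fun n => (w n).2) atTop (𝓝 (m - ‖x‖ ^ 2 / 2)) := by
    have := hφw.sub ((hx.norm.pow 2).div_const 2)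
    refine this.congr fun n => ?_
    simp [hφ]
  have hmem : (x, m - ‖x‖ ^ 2 / 2) ∈ E :=
    hclosed.mem_of_tendsto (hx.prodMk_nhds ht) (Eventually.of_forall hwE)
  refine ⟨_, hmem, fun w' hw' => ?_⟩
  have hφx : φ (x, m - ‖x‖ ^ 2 / 2) = m := by simp [hφ]
  -- Dividing the chord inequality by `s` and letting `s → 0⁺` gives the quadratic growth.
  have key : ∀ s : ℝ, 0 < s → s < 1 → (1 - s) / 2 * ‖w'.1 - x‖ ^ 2 ≤ φ w' - m := by
    intro s hs hs'
    have h := hchord _ hmem _ hw' s hs.le hs'.le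
    rw [hφx] at h
    refine le_of_mul_le_mul_left ?_ hs
    linarith
  have hlim : Tendsto (fun s : ℝ => (1 - s) / 2 * ‖w'.1 - x‖ ^ 2) (𝓝[>] 0)
      (𝓝 ((1 - 0) / 2 * ‖w'.1 - x‖ ^ 2)) :=
    (Continuous.tendsto (by fun_prop) 0).mono_left nhdsWithin_le_nhds
  have hle := le_of_tendsto hlim (by
    filter_upwards [Ioo_mem_nhdsGT (zero_lt_one' ℝ)] with s hs using key s hs.1 hs.2)
  simp only [hφ] at hle
  show m - ‖x‖ ^ 2 / 2 + ‖x‖ ^ 2 / 2 + ‖w'.1 - x‖ ^ 2 / 2 ≤ _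
  linarith

namespace SetValuedOp

variable {H : Type*} [NormedAddCommGroup H] [InnerProductSpace ℝ H]

theorem IsMaximallyMonotone.exists_mem {A : H → Set H} (hA : IsMaximallyMonotone A) :
    ∃ x u, u ∈ A x := by
  by_contra! h
  exact h 0 0 (hA.2 0 0 fun y v hv => absurd hv (h y v))

/-- Minty's theorem at the origin. The epigraph of the Fitzpatrick function
`(x, u) ↦ sup {⟪x, v⟫ + ⟪y, u⟫ - ⟪y, v⟫ | v ∈ A y}` is minimised after adding half the squared norm;
the minimiser `(x, u)` satisfies `u = -x` and belongs to the graph of `A`. -/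
theorem IsMaximallyMonotone.exists_neg_mem [CompleteSpace H] {A : H → Set H}
    (hA : IsMaximallyMonotone A) : ∃ x, -x ∈ A x := by
  set E : Set (WithLp 2 (H × H) × ℝ) :=
    {w | ∀ y : H, ∀ v ∈ A y, ⟪w.1.fst, v⟫_ℝ + ⟪y, w.1.snd⟫_ℝ - ⟪y, v⟫_ℝ ≤ w.2} with hE
  have hconv : Convex ℝ E := by
    intro a ha b hb s t hs ht hst y v hv
    have h1 := mul_le_mul_of_nonneg_left (ha y v hv) hs
    have h2 := mul_le_mul_of_nonneg_left (hb y v hv) ht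
    have h3 : (s + t) * ⟪y, v⟫_ℝ = ⟪y, v⟫_ℝ := by rw [hst, one_mul]
    simp only [Prod.fst_add, Prod.snd_add, Prod.smul_fst, Prod.smul_snd, smul_eq_mul,
      WithLp.add_fst, WithLp.add_snd, WithLp.smul_fst, WithLp.smul_snd, inner_add_left,
      inner_add_right, real_inner_smul_left, real_inner_smul_right]
    linarith
  have hclosed : IsClosed E := by
    simp only [hE, Set.ofPred_forall]
    refine isClosed_iInter fun y => isClosed_iInter fun v => isClosed_iInter fun _ =>
      isClosed_le ?_ continuous_snd
    have h1 : Continuous fun w : WithLp 2 (H × H) × ℝ => w.1.fst :=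
      (WithLp.prod_continuous_ofLp 2 H H).fst.comp continuous_fst
    have h2 : Continuous fun w : WithLp 2 (H × H) × ℝ => w.1.snd :=
      (WithLp.prod_continuous_ofLp 2 H H).snd.comp continuous_fst
    fun_prop
  -- Monotonicity puts the graph, at height `⟪y, v⟫`, into the epigraph.
  have hgraph : ∀ y : H, ∀ v ∈ A y, (WithLp.toLp 2 (y, v), ⟪y, v⟫_ℝ) ∈ E := by
    intro y v hv y' v' hv'
    have h := hA.1 y y' v hv v' hv'
    simp only [inner_sub_left, inner_sub_right] at h
    show ⟪y, v'⟫_ℝ + ⟪y', v⟫_ℝ - ⟪y', v'⟫_ℝ ≤ ⟪y, v⟫_ℝ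
    linarith
  -- Maximality makes the duality pairing a minorant of the Fitzpatrick function.
  have hminor : ∀ w ∈ E, ⟪w.1.fst, w.1.snd⟫_ℝ ≤ w.2 := by
    intro w hw
    by_contra! hlt
    have hmem := hA.2 w.1.fst w.1.snd fun y v hv => by
      have h := hw y v hv
      simp only [inner_sub_left, inner_sub_right]
      linarith
    have h := hw _ _ hmem
    linarith
  obtain ⟨y₀, v₀, hv₀⟩ := hA.exists_mem
  obtain ⟨w, hwE, hw⟩ := exists_forall_add_half_norm_sq_le hconv hclosed ⟨_, hgraph y₀ v₀ hv₀⟩ 0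
    fun w hw => by
      have h1 := hminor w hw
      have h2 := sq_nonneg ‖w.1.fst + w.1.snd‖
      rw [norm_add_sq_real] at h2
      rw [WithLp.prod_norm_sq_eq_of_L2]
      linarith
  set x := w.1.fst with hx
  set u := w.1.snd with hu
  -- Comparing the minimiser `(x, u)` with a point `(y, v)` of the graph shows that `(-u, -x)` is
  -- monotonically related to the graph.
  have key : ∀ y : H, ∀ v ∈ A y, ‖x + u‖ ^ 2 ≤ ⟪-u - y, -x - v⟫_ℝ := by
    intro y v hv
    have h := hw _ (hgraph y v hv)
    have h1 := hminor w hwE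
    simp only [WithLp.prod_norm_sq_eq_of_L2, WithLp.sub_fst, WithLp.sub_snd, ← hx, ← hu] at h h1
    change w.2 + (‖x‖ ^ 2 + ‖u‖ ^ 2) / 2 + (‖y - x‖ ^ 2 + ‖v - u‖ ^ 2) / 2
      ≤ ⟪y, v⟫_ℝ + (‖y‖ ^ 2 + ‖v‖ ^ 2) / 2 at h
    rw [norm_sub_sq_real, norm_sub_sq_real] at h
    rw [norm_add_sq_real]
    simp only [inner_sub_left, inner_sub_right, inner_neg_left, inner_neg_right]
    rw [real_inner_comm x u, real_inner_comm v u]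
    linarith
  have hmem : -x ∈ A (-u) := hA.2 _ _ fun y v hv => (sq_nonneg _).trans (key y v hv)
  have h0 := key _ _ hmem
  rw [sub_self, inner_zero_left] at h0
  have hxu : x + u = 0 := by
    rw [← norm_eq_zero]
    exact pow_eq_zero_iff two_ne_zero |>.1 (le_antisymm h0 (sq_nonneg _))
  refine ⟨x, ?_⟩
  rwa [← eq_neg_of_add_eq_zero_left hxu] at hmem

/-- **Minty's theorem**: the resolvent of a maximally monotone operator has full domain. -/
theorem IsMaximallyMonotone.exists_sub_mem [CompleteSpace H] {A : H → Set H}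
    (hA : IsMaximallyMonotone A) (z : H) : ∃ x, z - x ∈ A x := by
  have hA' : IsMaximallyMonotone fun x => {u | u + z ∈ A x} := by
    refine ⟨fun x y u hu v hv => ?_, fun x u h => hA.2 _ _ fun y v hv => ?_⟩
    · simpa using hA.1 x y _ hu _ hv
    · have := h y (v - z) (by simpa using hv)
      rwa [show u + z - v = u - (v - z) by abel]
  obtain ⟨x, hx⟩ := hA'.exists_neg_mem
  exact ⟨x, by rwa [sub_eq_neg_add]⟩

end SetValuedOp

/-! ### Krasnosel'skiĭ–Mann iteration -/

section KrasnoselskiiMann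

variable {K : Type*} [NormedAddCommGroup K] [InnerProductSpace ℝ K]

theorem tendsto_toWeakSpace_iff_inner [CompleteSpace K] {ι : Type*} {l : Filter ι} {f : ι → K}
    {y : K} :
    Tendsto (fun n => toWeakSpace ℝ K (f n)) l (𝓝 (toWeakSpace ℝ K y)) ↔
      ∀ v, Tendsto (fun n => ⟪v, f n⟫_ℝ) l (𝓝 ⟪v, y⟫_ℝ) := by
  have hinj : Function.Injective (topDualPairing ℝ K).flip := by
    intro a b hab
    refine ext_inner_left ℝ fun v => ?_
    simpa using LinearMap.congr_fun hab (InnerProductSpace.toDual ℝ K v)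
  refine (WeakBilin.tendsto_iff_forall_eval_tendsto _ hinj).trans ⟨fun h v => ?_, fun h φ => ?_⟩
  · simpa using! h (InnerProductSpace.toDual ℝ K v)
  · have := h ((InnerProductSpace.toDual ℝ K).symm φ)
    simp only [InnerProductSpace.toDual_symm_apply] at this
    exact this

/-- Bounded sets are relatively weakly compact: the Banach–Alaoglu theorem transported along the
Riesz isometry. -/
theorem Ultrafilter.exists_tendsto_inner_of_norm_le [CompleteSpace K] {ι : Type*}
    (U : Ultrafilter ι) {f : ι → K} {R : ℝ} (hf : ∀ n, ‖f n‖ ≤ R) :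
    ∃ y, ∀ v, Tendsto (fun n => ⟪v, f n⟫_ℝ) U (𝓝 ⟪v, y⟫_ℝ) := by
  let g : ι → WeakDual ℝ K := fun n => StrongDual.toWeakDual (InnerProductSpace.toDual ℝ K (f n))
  obtain ⟨φ, -, hφ⟩ := isCompact_iff_ultrafilter_le_nhds.1
    (WeakDual.isCompact_closedBall (𝕜 := ℝ) (E := K) 0 R) (U.map g) (by
      refine le_principal_iff.2 (Filter.mem_map.2 (Eventually.of_forall fun n => ?_))
      show InnerProductSpace.toDual ℝ K (f n) ∈ Metric.closedBall _ R
      simpa using hf n)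
  refine ⟨(InnerProductSpace.toDual ℝ K).symm (WeakDual.toStrongDual φ), fun v => ?_⟩
  have h := tendsto_iff_forall_eval_tendsto_topDualPairing.1
    (show Tendsto g U (𝓝 φ) from hφ) v
  simp only [real_inner_comm _ v]
  rw [InnerProductSpace.toDual_symm_apply]
  exact h

/-- Demiclosedness of `Id - T` at `0` for a nonexpansive map `T`. -/
theorem LipschitzWith.isFixedPt_of_tendsto_inner {T : K → K} (hT : LipschitzWith 1 T)
    {ι : Type*} {l : Filter ι} [l.NeBot] {f : ι → K} {R : ℝ} (hf : ∀ n, ‖f n‖ ≤ R) {y : K}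
    (hy : ∀ v, Tendsto (fun n => ⟪v, f n⟫_ℝ) l (𝓝 ⟪v, y⟫_ℝ))
    (hres : Tendsto (fun n => ‖f n - T (f n)‖) l (𝓝 0)) : T y = y := by
  have hbound : ∀ n, ‖y - T y‖ ^ 2 ≤ -2 * (⟪y - T y, f n⟫_ℝ - ⟪y - T y, y⟫_ℝ)
      + 2 * ‖f n - T (f n)‖ * (R + ‖y‖) + ‖f n - T (f n)‖ ^ 2 := by
    intro n
    have h1 : ‖f n - T y‖ ≤ ‖f n - T (f n)‖ + ‖f n - y‖ :=
      (norm_sub_le_norm_sub_add_norm_sub _ (T (f n)) _).trans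
        (add_le_add_right (by simpa using hT.norm_sub_le (f n) y) _)
    have h2 : ‖f n - y‖ ≤ R + ‖y‖ := (_root_.norm_sub_le _ _).trans (add_le_add_left (hf n) _)
    have h3 : ‖f n - T y‖ ^ 2 =
        ‖f n - y‖ ^ 2 + 2 * (⟪y - T y, f n⟫_ℝ - ⟪y - T y, y⟫_ℝ) + ‖y - T y‖ ^ 2 := by
      rw [← inner_sub_right, real_inner_comm, ← norm_add_sq_real, sub_add_sub_cancel]
    have h4 := pow_le_pow_left₀ (norm_nonneg _) h1 2
    have h5 := mul_le_mul_of_nonneg_left h2 (norm_nonneg (f n - T (f n)))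
    linarith
  have hlim : Tendsto (fun n => -2 * (⟪y - T y, f n⟫_ℝ - ⟪y - T y, y⟫_ℝ)
      + 2 * ‖f n - T (f n)‖ * (R + ‖y‖) + ‖f n - T (f n)‖ ^ 2) l (𝓝 0) := by
    have h := ((((hy (y - T y)).sub_const ⟪y - T y, y⟫_ℝ).const_mul (-2)).add
      ((hres.const_mul 2).mul_const (R + ‖y‖))).add (hres.pow 2)
    simpa using h
  have h0 : ‖y - T y‖ ^ 2 ≤ 0 := ge_of_tendsto' hlim hbound
  have h1 : ‖y - T y‖ = 0 := pow_eq_zero_iff two_ne_zero |>.1 (le_antisymm h0 (sq_nonneg _))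
  exact (sub_eq_zero.1 (norm_eq_zero.1 h1)).symm

/-- Opial's lemma for nonexpansive maps. All weak limits of `f` along ultrafilters finer than
`atTop` are fixed points, and any two of them agree because the distances from `f` to both
converge. -/
theorem exists_isFixedPt_tendsto_inner [CompleteSpace K] {T : K → K} (hT : LipschitzWith 1 T)
    {f : ℕ → K} {R : ℝ} (hf : ∀ n, ‖f n‖ ≤ R)
    (hres : Tendsto (fun n => ‖f n - T (f n)‖) atTop (𝓝 0))
    (hdist : ∀ y, T y = y → ∃ d, Tendsto (fun n => ‖f n - y‖) atTop (𝓝 d)) :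
    ∃ y, T y = y ∧ ∀ v, Tendsto (fun n => ⟪v, f n⟫_ℝ) atTop (𝓝 ⟪v, y⟫_ℝ) := by
  have hlim : ∀ U : Ultrafilter ℕ, (U : Filter ℕ) ≤ atTop →
      ∃ y, T y = y ∧ ∀ v, Tendsto (fun n => ⟪v, f n⟫_ℝ) U (𝓝 ⟪v, y⟫_ℝ) := by
    intro U hU
    obtain ⟨y, hy⟩ := U.exists_tendsto_inner_of_norm_le hf
    exact ⟨y, hT.isFixedPt_of_tendsto_inner hf hy (hres.mono_left hU), hy⟩
  obtain ⟨y, hTy, hy⟩ := hlim (Ultrafilter.of atTop) (Ultrafilter.of_le _)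
  refine ⟨y, hTy, fun v => (tendsto_iff_ultrafilter _ _ _).2 fun U hU => ?_⟩
  obtain ⟨y', hTy', hy'⟩ := hlim U hU
  obtain ⟨d, hd⟩ := hdist y hTy
  obtain ⟨d', hd'⟩ := hdist y' hTy'
  -- `‖f n - y'‖² - ‖f n - y‖²` is affine in `⟪y - y', f n⟫`, so the latter converges.
  have hconv : Tendsto (fun n => ⟪y - y', f n⟫_ℝ) atTop
      (𝓝 ((d' ^ 2 - d ^ 2 - ‖y'‖ ^ 2 + ‖y‖ ^ 2) / 2)) := by
    refine (((((hd'.pow 2).sub (hd.pow 2)).sub_const _).add_const _).div_const 2).congr fun n => ?_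
    rw [norm_sub_sq_real, norm_sub_sq_real, inner_sub_left, real_inner_comm y, real_inner_comm y']
    ring
  have h1 := tendsto_nhds_unique (hy (y - y')) (hconv.mono_left (Ultrafilter.of_le _))
  have h2 := tendsto_nhds_unique (hy' (y - y')) (hconv.mono_left hU)
  have h3 : y = y' := by
    rw [← sub_eq_zero, ← inner_self_eq_zero (𝕜 := ℝ), inner_sub_right, h1, h2, sub_self]
  exact h3 ▸ hy' v

theorem norm_one_sub_smul_add_smul_sq (a b : K) (t : ℝ) :
    ‖(1 - t) • a + t • b‖ ^ 2 =
      (1 - t) * ‖a‖ ^ 2 + t * ‖b‖ ^ 2 - t * (1 - t) * ‖a - b‖ ^ 2 := by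
  rw [norm_add_sq_real, norm_sub_sq_real, norm_smul, norm_smul, real_inner_smul_left,
    real_inner_smul_right, mul_pow, mul_pow, Real.norm_eq_abs, Real.norm_eq_abs, sq_abs, sq_abs]
  ring

/-- The Krasnosel'skiĭ–Mann theorem: the distances to fixed points decrease, and their total
decrease controls `∑ λₙ (1 - λₙ) ‖xₙ - T xₙ‖²`. Since the residuals `‖xₙ - T xₙ‖` decrease, they
tend to `0` when `∑ λₙ (1 - λₙ)` diverges. -/
theorem krasnoselskii_mann [CompleteSpace K] {T : K → K} (hT : LipschitzWith 1 T)
    {y₀ : K} (hy₀ : T y₀ = y₀) {lam : ℕ → ℝ} (hlam : ∀ n, lam n ∈ Set.Icc (0 : ℝ) 1)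
    (hsum : Tendsto (fun N : ℕ => ∑ n ∈ Finset.range N, lam n * (1 - lam n)) atTop atTop)
    {x : ℕ → K} (hx : ∀ n, x (n + 1) = (1 - lam n) • x n + lam n • T (x n)) :
    Tendsto (fun n => ‖x n - T (x n)‖) atTop (𝓝 0) ∧
      (∀ n, ‖x n - y₀‖ ≤ ‖x 0 - y₀‖) ∧
      ∃ y, T y = y ∧ ∀ v, Tendsto (fun n => ⟪v, x n⟫_ℝ) atTop (𝓝 ⟪v, y⟫_ℝ) := by
  have hne : ∀ a b, ‖T a - T b‖ ≤ ‖a - b‖ := fun a b => by simpa using hT.norm_sub_le a b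
  have hdec : ∀ y, T y = y → ∀ n,
      ‖x (n + 1) - y‖ ^ 2 ≤ ‖x n - y‖ ^ 2 - lam n * (1 - lam n) * ‖x n - T (x n)‖ ^ 2 := by
    intro y hy n
    have h1 : x (n + 1) - y = (1 - lam n) • (x n - y) + lam n • (T (x n) - y) := by
      rw [hx]; module
    have h2 : ‖T (x n) - y‖ ^ 2 ≤ ‖x n - y‖ ^ 2 := by
      have := hne (x n) y
      rw [hy] at this
      exact pow_le_pow_left₀ (norm_nonneg _) this 2
    rw [h1, norm_one_sub_smul_add_smul_sq, sub_sub_sub_cancel_right]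
    have := mul_le_mul_of_nonneg_left h2 (hlam n).1
    linarith
  have hanti : ∀ y, T y = y → Antitone fun n => ‖x n - y‖ := by
    intro y hy
    refine antitone_nat_of_succ_le fun n => ?_
    refine le_of_sq_le_sq ?_ (norm_nonneg _)
    have := mul_nonneg (mul_nonneg (hlam n).1 (sub_nonneg.2 (hlam n).2))
      (sq_nonneg ‖x n - T (x n)‖)
    linarith [hdec y hy n]
  have hdist : ∀ y, T y = y → ∃ d, Tendsto (fun n => ‖x n - y‖) atTop (𝓝 d) := fun y hy =>
    ⟨_, tendsto_atTop_ciInf (hanti y hy) ⟨0, by rintro _ ⟨n, rfl⟩; exact norm_nonneg _⟩⟩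
  have hresanti : Antitone fun n => ‖x n - T (x n)‖ := by
    refine antitone_nat_of_succ_le fun n => ?_
    have h1 : x (n + 1) - T (x (n + 1)) =
        (1 - lam n) • (x n - T (x n)) + (T (x n) - T (x (n + 1))) := by
      rw [hx]; module
    have h2 : x n - x (n + 1) = lam n • (x n - T (x n)) := by rw [hx]; module
    have h3 := hne (x n) (x (n + 1))
    rw [h2, norm_smul, Real.norm_of_nonneg (hlam n).1] at h3
    rw [h1]
    refine (norm_add_le _ _).trans ?_
    rw [norm_smul, Real.norm_of_nonneg (sub_nonneg.2 (hlam n).2)]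
    linarith
  have htele : ∀ N, ∑ n ∈ Finset.range N, lam n * (1 - lam n) * ‖x n - T (x n)‖ ^ 2
      ≤ ‖x 0 - y₀‖ ^ 2 - ‖x N - y₀‖ ^ 2 := by
    intro N
    induction N with
    | zero => simp
    | succ N ih => rw [Finset.sum_range_succ]; linarith [hdec y₀ hy₀ N]
  have hres : Tendsto (fun n => ‖x n - T (x n)‖) atTop (𝓝 0) := by
    have hlim := tendsto_atTop_ciInf hresanti ⟨0, by rintro _ ⟨n, rfl⟩; exact norm_nonneg _⟩
    set c := ⨅ n, ‖x n - T (x n)‖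
    have hc : ∀ n, c ≤ ‖x n - T (x n)‖ := hresanti.le_of_tendsto hlim
    have hc0 : 0 ≤ c := ge_of_tendsto' hlim fun n => norm_nonneg _
    rcases hc0.eq_or_lt with h0 | h0
    · rwa [h0]
    exfalso
    obtain ⟨N, hN⟩ := (hsum.eventually_gt_atTop (‖x 0 - y₀‖ ^ 2 / c ^ 2)).exists
    rw [div_lt_iff₀ (by positivity), Finset.sum_mul] at hN
    have h1 : ∑ n ∈ Finset.range N, lam n * (1 - lam n) * c ^ 2
        ≤ ∑ n ∈ Finset.range N, lam n * (1 - lam n) * ‖x n - T (x n)‖ ^ 2 :=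
      Finset.sum_le_sum fun n _ => mul_le_mul_of_nonneg_left
        (pow_le_pow_left₀ hc0 (hc n) 2) (mul_nonneg (hlam n).1 (sub_nonneg.2 (hlam n).2))
    linarith [htele N, sq_nonneg ‖x N - y₀‖]
  have hfejer : ∀ n, ‖x n - y₀‖ ≤ ‖x 0 - y₀‖ := fun n => hanti y₀ hy₀ (Nat.zero_le n)
  refine ⟨hres, hfejer, exists_isFixedPt_tendsto_inner hT (R := ‖x 0 - y₀‖ + ‖y₀‖)
    (fun n => ?_) hres hdist⟩
  linarith [norm_le_norm_sub_add (x n) y₀, hfejer n]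

end KrasnoselskiiMann

/-! ### Resolvents of monotone operators -/

namespace SetValuedOp

theorem mem_resolvent {E : Type*} [NormedAddCommGroup E] {A : E → Set E} {u a : E} :
    a ∈ resolvent A u ↔ u - a ∈ A a := by
  show u ∈ ({a} : Set E) + A a ↔ _
  rw [Set.singleton_add, Set.image_add_left, Set.mem_preimage, neg_add_eq_sub]

theorem mem_ran_idOp_add {E : Type*} [NormedAddCommGroup E] {A : E → Set E} {u : E} :
    u ∈ ran (idOp + A) ↔ ∃ a, u - a ∈ A a :=
  exists_congr fun _ => mem_resolvent

variable {H : Type*} [NormedAddCommGroup H] [InnerProductSpace ℝ H]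

theorem mem_smul_sum {r : ℕ} {A : Fin r → H → Set H} {c : ℝ} {z u : H} :
    u ∈ (c • ∑ i, A i) z ↔ ∃ a : Fin r → H, (∀ i, a i ∈ A i z) ∧ u = c • ∑ i, a i := by
  rw [Pi.smul_apply, Finset.sum_apply, Set.mem_smul_set]
  constructor
  · rintro ⟨s, hs, rfl⟩
    obtain ⟨a, ha, rfl⟩ := (Set.mem_fintype_sum _ _).1 hs
    exact ⟨a, ha, rfl⟩
  · rintro ⟨a, ha, rfl⟩
    exact ⟨_, (Set.mem_fintype_sum _ _).2 ⟨a, ha, rfl⟩, rfl⟩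

theorem mem_smul_innerPerturb_neg {A : H → Set H} {γ : ℝ} (hγ : 0 < γ) {q x u : H} :
    u ∈ (γ • innerPerturb A (-q)) x ↔ γ⁻¹ • u ∈ A (x + q) := by
  rw [Pi.smul_apply, Set.mem_smul_set_iff_inv_smul_mem₀ hγ.ne', innerPerturb, sub_neg_eq_add]

theorem IsMonotone.smul_sum {r : ℕ} {A : Fin r → H → Set H} (hA : ∀ i, IsMonotone (A i)) {c : ℝ}
    (hc : 0 ≤ c) : IsMonotone (c • ∑ i, A i) := by
  intro x y u hu v hv
  obtain ⟨a, ha, rfl⟩ := mem_smul_sum.1 hu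
  obtain ⟨b, hb, rfl⟩ := mem_smul_sum.1 hv
  rw [← smul_sub, ← Finset.sum_sub_distrib, real_inner_smul_right, inner_sum]
  exact mul_nonneg hc (Finset.sum_nonneg fun i _ => hA i x y _ (ha i) _ (hb i))

theorem IsMaximallyMonotone.smul_innerPerturb_neg {A : H → Set H} (hA : IsMaximallyMonotone A)
    {γ : ℝ} (hγ : 0 < γ) (q : H) : IsMaximallyMonotone (γ • innerPerturb A (-q)) := by
  refine ⟨fun x y u hu v hv => ?_, fun x u h => ?_⟩
  · rw [mem_smul_innerPerturb_neg hγ] at hu hv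
    have h := hA.1 _ _ _ hu _ hv
    rw [add_sub_add_right_eq_sub, ← smul_sub, real_inner_smul_right] at h
    exact nonneg_of_mul_nonneg_right h (inv_pos.2 hγ)
  · refine (mem_smul_innerPerturb_neg hγ).2 (hA.2 _ _ fun y v hv => ?_)
    have h1 := h (y - q) (γ • v) ((mem_smul_innerPerturb_neg hγ).2 (by
      rwa [inv_smul_smul₀ hγ.ne', sub_add_cancel]))
    have h2 : ⟪x + q - y, γ⁻¹ • u - v⟫_ℝ = γ⁻¹ * ⟪x - (y - q), u - γ • v⟫_ℝ := by
      rw [← real_inner_smul_right, smul_sub, inv_smul_smul₀ hγ.ne', sub_sub_eq_add_sub]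
    rw [h2]
    exact mul_nonneg (inv_pos.2 hγ).le h1

/-- Resolvents of monotone operators are firmly nonexpansive. -/
theorem IsMonotone.norm_sub_sq_le_inner {A : H → Set H} (hA : IsMonotone A) {u v a b : H}
    (ha : u - a ∈ A a) (hb : v - b ∈ A b) : ‖a - b‖ ^ 2 ≤ ⟪a - b, u - v⟫_ℝ := by
  have h := hA a b _ ha _ hb
  rwa [sub_sub_sub_comm, inner_sub_right, real_inner_self_eq_norm_sq, sub_nonneg] at h

theorem IsMonotone.eq_of_sub_mem {A : H → Set H} (hA : IsMonotone A) {u a b : H}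
    (ha : u - a ∈ A a) (hb : u - b ∈ A b) : a = b := by
  have h := hA.norm_sub_sq_le_inner ha hb
  rw [sub_self, inner_zero_right] at h
  exact sub_eq_zero.1
    (norm_eq_zero.1 (pow_eq_zero_iff two_ne_zero |>.1 (le_antisymm h (sq_nonneg _))))

theorem IsMonotone.resolvent_eq_singleton {A : H → Set H} (hA : IsMonotone A) {u a : H}
    (ha : u - a ∈ A a) : resolvent A u = {a} :=
  Set.eq_singleton_iff_unique_mem.2
    ⟨mem_resolvent.2 ha, fun _ hb => hA.eq_of_sub_mem (mem_resolvent.1 hb) ha⟩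

theorem IsMonotone.modReflResolvent_eq_singleton {A : H → Set H} (hA : IsMonotone A) (β : ℝ)
    {u a : H} (ha : u - a ∈ A a) : modReflResolvent β A u = {(2 * β) • a - u} := by
  show (2 * β) • resolvent A u - {u} = _
  rw [hA.resolvent_eq_singleton ha, Set.smul_set_singleton, Set.singleton_sub_singleton]

/-- The modified reflected resolvent is nonexpansive for `β ∈ [0, 1]`. -/
theorem IsMonotone.norm_modRefl_sub_le {A : H → Set H} (hA : IsMonotone A) {β : ℝ} (hβ₀ : 0 ≤ β)
    (hβ₁ : β ≤ 1) {u v a b : H} (ha : u - a ∈ A a) (hb : v - b ∈ A b) :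
    ‖((2 * β) • a - u) - ((2 * β) • b - v)‖ ^ 2 ≤ ‖u - v‖ ^ 2 := by
  have h := hA.norm_sub_sq_le_inner ha hb
  have h1 : ((2 * β) • a - u) - ((2 * β) • b - v) = (2 * β) • (a - b) - (u - v) := by module
  rw [h1, norm_sub_sq_real, norm_smul, real_inner_smul_left, mul_pow, Real.norm_eq_abs, sq_abs]
  nlinarith [mul_le_mul_of_nonneg_left h hβ₀,
    mul_nonneg (mul_nonneg hβ₀ (sub_nonneg.2 hβ₁)) (sq_nonneg ‖a - b‖)]

/-! ### The AAMR operator on the product space -/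

theorem sum_eq_smul_average {r : ℕ} (hr : 0 < r) (x : Fin r → H) :
    ∑ i, x i = (r : ℝ) • average x := by
  rw [average, smul_smul, mul_one_div_cancel (by positivity), one_smul]

theorem average_sub {r : ℕ} (x y : Fin r → H) :
    average (x - y) = average x - average y := by
  simp only [average, Pi.sub_apply, Finset.sum_sub_distrib, smul_sub]

/-- One full step (`λ = 1`) of the parallel AAMR scheme, as a self-map of the Hilbert product space,
for single-valued resolvents `J i`. -/
noncomputable def aamrMap {r : ℕ} (β : ℝ) (J : Fin r → H → H) (x : PiLp 2 fun _ : Fin r => H) :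
    PiLp 2 fun _ : Fin r => H :=
  WithLp.toLp 2 fun i =>
    (2 * β) • J i ((2 * β) • average x.ofLp - x i) - ((2 * β) • average x.ofLp - x i)

/-- `2 β P - Id`, with `P` the averaging projection, decreases the squared distance by
`4 β (1 - β)` times that of the projections, and the modified reflected resolvents are
nonexpansive. -/
theorem norm_aamrMap_sub_sq_le {r : ℕ} (hr : 0 < r) {B : Fin r → H → Set H}
    (hB : ∀ i, IsMonotone (B i)) {J : Fin r → H → H} (hJ : ∀ i u, u - J i u ∈ B i (J i u)) {β : ℝ}
    (hβ₀ : 0 ≤ β) (hβ₁ : β ≤ 1) (x y : PiLp 2 fun _ : Fin r => H) :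
    ‖aamrMap β J x - aamrMap β J y‖ ^ 2
        + 4 * β * (1 - β) * r * ‖average x.ofLp - average y.ofLp‖ ^ 2 ≤ ‖x - y‖ ^ 2 := by
  set p := average x.ofLp - average y.ofLp with hp
  have h1 : ∀ i, ‖(aamrMap β J x - aamrMap β J y) i‖ ^ 2 ≤ ‖(2 * β) • p - (x - y) i‖ ^ 2 := by
    intro i
    refine ((hB i).norm_modRefl_sub_le hβ₀ hβ₁ (hJ i _) (hJ i _)).trans (le_of_eq ?_)
    congr 2
    rw [hp, PiLp.sub_apply]
    module
  have hsum : ∑ i, (x - y) i = (r : ℝ) • p := by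
    rw [hp, ← average_sub, ← sum_eq_smul_average hr]
    rfl
  have h2 : ∑ i, ‖(2 * β) • p - (x - y) i‖ ^ 2
      = ∑ i, ‖(x - y) i‖ ^ 2 - 4 * β * (1 - β) * r * ‖p‖ ^ 2 := by
    simp only [norm_sub_sq_real, norm_smul, mul_pow, Real.norm_eq_abs, sq_abs]
    rw [Finset.sum_add_distrib, Finset.sum_sub_distrib, ← Finset.mul_sum, ← Finset.mul_sum,
      ← inner_sum, hsum, Finset.sum_const, Finset.card_univ, Fintype.card_fin, real_inner_smul_left,
      real_inner_smul_right, real_inner_self_eq_norm_sq, nsmul_eq_mul]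
    ring
  rw [PiLp.norm_sq_eq_of_L2, PiLp.norm_sq_eq_of_L2]
  linarith [Finset.sum_le_sum fun i (_ : i ∈ Finset.univ) => h1 i]

theorem lipschitzWith_aamrMap {r : ℕ} (hr : 0 < r) {B : Fin r → H → Set H}
    (hB : ∀ i, IsMonotone (B i)) {J : Fin r → H → H} (hJ : ∀ i u, u - J i u ∈ B i (J i u)) {β : ℝ}
    (hβ₀ : 0 ≤ β) (hβ₁ : β ≤ 1) : LipschitzWith 1 (aamrMap β J) := by
  refine LipschitzWith.of_dist_le_mul fun x y => ?_
  rw [NNReal.coe_one, one_mul, dist_eq_norm, dist_eq_norm]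
  have h := norm_aamrMap_sub_sq_le hr hB hJ hβ₀ hβ₁ x y
  have h1 : 0 ≤ 4 * β * (1 - β) * r * ‖average x.ofLp - average y.ofLp‖ ^ 2 :=
    mul_nonneg (mul_nonneg (mul_nonneg (by positivity) (sub_nonneg.2 hβ₁)) r.cast_nonneg)
      (sq_nonneg _)
  exact le_of_sq_le_sq (by linarith) (norm_nonneg _)

theorem aamrMap_eq_self_iff {r : ℕ} {J : Fin r → H → H} {β : ℝ} (hβ : β ≠ 0)
    {x : PiLp 2 fun _ : Fin r => H} :
    aamrMap β J x = x ↔ ∀ i, J i ((2 * β) • average x.ofLp - x i) = average x.ofLp := by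
  rw [PiLp.ext_iff]
  refine forall_congr' fun i => ?_
  show (2 * β) • J i _ - ((2 * β) • average x.ofLp - x i) = x i ↔ _
  rw [sub_eq_iff_eq_add, add_sub_cancel]
  exact (smul_right_injective H (mul_ne_zero two_ne_zero hβ)).eq_iff

/-- A solution `z` of the resolvent inclusion for the sum yields a fixed point of the AAMR operator:
if `q - z` is the multiple `γ / (2 r (1 - β))` of `∑ i, a i` with `a i ∈ A i z`, then the point
`x i = (2 β - 1) (z - q) - γ a i` is fixed and has average `z - q`. -/
theorem exists_aamrMap_eq_self {r : ℕ} (hr : 0 < r) {A : Fin r → H → Set H} {γ β : ℝ} {q z : H}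
    (hγ : 0 < γ) (hβ₀ : 0 < β) (hβ₁ : β < 1)
    (hB : ∀ i, IsMonotone (γ • innerPerturb (A i) (-q))) {J : Fin r → H → H}
    (hJ : ∀ i u, u - J i u ∈ (γ • innerPerturb (A i) (-q)) (J i u))
    (hz : q - z ∈ ((γ / (2 * (r : ℝ) * (1 - β))) • ∑ i, A i) z) :
    ∃ x, aamrMap β J x = x := by
  obtain ⟨a, ha, hqz⟩ := mem_smul_sum.1 hz
  have hr' : (r : ℝ) ≠ 0 := by positivity
  have hβ' : 1 - β ≠ 0 := (sub_pos.2 hβ₁).ne'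
  have hsum : ∑ i, a i = (2 * r * (1 - β) / γ) • (q - z) := by
    rw [hqz, smul_smul]
    field_simp
    rw [one_smul]
  have havg : average (fun i => (2 * β - 1) • (z - q) - γ • a i) = z - q := by
    rw [average, Finset.sum_sub_distrib, Finset.sum_const, Finset.card_univ, Fintype.card_fin,
      ← Finset.smul_sum, hsum, ← Nat.cast_smul_eq_nsmul ℝ]
    match_scalars <;> field_simp <;> ring
  refine ⟨WithLp.toLp 2 fun i => (2 * β - 1) • (z - q) - γ • a i,
    (aamrMap_eq_self_iff hβ₀.ne').2 fun i => ?_⟩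
  refine (hB i).eq_of_sub_mem (hJ i _) ?_
  rw [mem_smul_innerPerturb_neg hγ]
  show γ⁻¹ • ((2 * β) • average (fun i => (2 * β - 1) • (z - q) - γ • a i)
    - ((2 * β - 1) • (z - q) - γ • a i) - average fun i => (2 * β - 1) • (z - q) - γ • a i) ∈
    A i (average (fun i => (2 * β - 1) • (z - q) - γ • a i) + q)
  rw [havg, sub_add_cancel]
  convert! ha i using 1
  match_scalars <;> field_simp <;> ring

/-- The average of a fixed point of the AAMR operator, translated by `q`, solves the resolvent
inclusion for the sum. -/
theorem sub_mem_of_aamrMap_eq_self {r : ℕ} (hr : 0 < r) {A : Fin r → H → Set H} {γ β : ℝ} {q : H}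
    (hγ : 0 < γ) (hβ₀ : 0 < β) (hβ₁ : β < 1) {J : Fin r → H → H}
    (hJ : ∀ i u, u - J i u ∈ (γ • innerPerturb (A i) (-q)) (J i u))
    {x : PiLp 2 fun _ : Fin r => H} (hx : aamrMap β J x = x) :
    q - (q + average x.ofLp) ∈
      ((γ / (2 * (r : ℝ) * (1 - β))) • ∑ i, A i) (q + average x.ofLp) := by
  have hr' : (r : ℝ) ≠ 0 := by positivity
  have hβ' : 1 - β ≠ 0 := (sub_pos.2 hβ₁).ne'
  rw [aamrMap_eq_self_iff hβ₀.ne'] at hx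
  set p := average x.ofLp with hp
  refine mem_smul_sum.2 ⟨fun i => γ⁻¹ • ((2 * β) • p - x i - p), fun i => ?_, ?_⟩
  · have h := hJ i ((2 * β) • p - x i)
    rwa [hx i, mem_smul_innerPerturb_neg hγ, add_comm] at h
  · rw [← Finset.smul_sum, Finset.sum_sub_distrib, Finset.sum_sub_distrib,
      sum_eq_smul_average hr x.ofLp, ← hp, Finset.sum_const, Finset.sum_const, Finset.card_univ,
      Fintype.card_fin, ← Nat.cast_smul_eq_nsmul ℝ, ← Nat.cast_smul_eq_nsmul ℝ]
    match_scalars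
    · ring
    · field_simp
      ring

/-- For single-valued resolvents, the parallel AAMR scheme is the relaxed iteration of the AAMR
operator. -/
theorem isParallelAAMR_iff {r : ℕ} {A : Fin r → H → Set H} {γ β : ℝ} {lam : ℕ → ℝ} {q : H}
    (hB : ∀ i, IsMonotone (γ • innerPerturb (A i) (-q))) {J : Fin r → H → H}
    (hJ : ∀ i u, u - J i u ∈ (γ • innerPerturb (A i) (-q)) (J i u)) {x₀ : Fin r → H}
    {x : ℕ → Fin r → H} :
    IsParallelAAMR A γ β lam q x₀ x ↔ x 0 = x₀ ∧ ∀ n, x (n + 1) =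
      (1 - lam n) • x n + lam n • (aamrMap β J (WithLp.toLp 2 (x n))).ofLp := by
  refine and_congr_right fun _ => forall_congr' fun n => ?_
  rw [funext_iff]
  refine forall_congr' fun i => ?_
  rw [(hB i).modReflResolvent_eq_singleton β (hJ i _)]
  simp [aamrMap]

/-- Strong convergence of the averages: `norm_aamrMap_sub_sq_le` bounds their squared distance to
the limit by `‖x n - T (x n)‖`, up to a constant. -/
theorem tendsto_average_of_tendsto_residual {r : ℕ} (hr : 0 < r) {B : Fin r → H → Set H}
    (hB : ∀ i, IsMonotone (B i)) {J : Fin r → H → H} (hJ : ∀ i u, u - J i u ∈ B i (J i u)) {β : ℝ}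
    (hβ₀ : 0 < β) (hβ₁ : β < 1) {x : ℕ → PiLp 2 fun _ : Fin r => H} {y : PiLp 2 fun _ : Fin r => H}
    (hy : aamrMap β J y = y) {R : ℝ} (hR : ∀ n, ‖x n - y‖ ≤ R)
    (hres : Tendsto (fun n => ‖x n - aamrMap β J (x n)‖) atTop (𝓝 0)) :
    Tendsto (fun n => average (x n).ofLp) atTop (𝓝 (average y.ofLp)) := by
  have hc : 0 < 4 * β * (1 - β) * r :=
    mul_pos (mul_pos (by positivity) (sub_pos.2 hβ₁)) (by positivity)
  have hbound : ∀ n, ‖average (x n).ofLp - average y.ofLp‖ ^ 2 ≤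
      (4 * β * (1 - β) * r)⁻¹ * (‖x n - aamrMap β J (x n)‖ * (2 * R)) := by
    intro n
    rw [inv_mul_eq_div, le_div_iff₀' hc]
    have h := norm_aamrMap_sub_sq_le hr hB hJ hβ₀.le hβ₁.le (x n) y
    rw [hy] at h
    have h1 : ‖x n - y‖ - ‖aamrMap β J (x n) - y‖ ≤ ‖x n - aamrMap β J (x n)‖ := by
      simpa using norm_sub_norm_le (x n - y) (aamrMap β J (x n) - y)
    have h2 : ‖aamrMap β J (x n) - y‖ ≤ ‖x n - y‖ := by
      have := (lipschitzWith_aamrMap hr hB hJ hβ₀.le hβ₁.le).norm_sub_le (x n) y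
      simpa [hy] using this
    nlinarith [mul_le_mul h1 (add_le_add (hR n) (h2.trans (hR n)))
      (add_nonneg (norm_nonneg _) (norm_nonneg _)) (norm_nonneg _)]
  have hlim := ((hres.mul_const (2 * R)).const_mul (4 * β * (1 - β) * r)⁻¹)
  rw [zero_mul, mul_zero] at hlim
  have hsq := squeeze_zero (fun n => sq_nonneg _) hbound hlim
  rw [tendsto_iff_norm_sub_tendsto_zero]
  simpa [Real.sqrt_sq] using hsq.sqrt

end SetValuedOp

/-! ### Convergence of the parallel AAMR algorithm -/

theorem mainTheorem2 {H : Type*} [NormedAddCommGroup H] [InnerProductSpace ℝ H] [CompleteSpace H]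
    (r : ℕ) (hr : 0 < r)
    (A : Fin r → H → Set H) (hA : ∀ i, SetValuedOp.IsMaximallyMonotone (A i))
    (γ : ℝ) (hγ : 0 < γ)
    (lam : ℕ → ℝ) (hlam : ∀ n, lam n ∈ Set.Icc (0 : ℝ) 1)
    (hsum : Tendsto (fun N : ℕ => ∑ n ∈ Finset.range N, lam n * (1 - lam n)) atTop atTop)
    (β : ℝ) (hβ : β ∈ Set.Ioo (0 : ℝ) 1)
    (q : H)
    (hq : q ∈ SetValuedOp.ran
      (SetValuedOp.idOp + (γ / (2 * (r : ℝ) * (1 - β))) • ∑ i, A i))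
    (x₀ : Fin r → H) :
    -- the scheme is well defined
    (∃! x : ℕ → Fin r → H, SetValuedOp.IsParallelAAMR A γ β lam q x₀ x) ∧
    -- the convergence assertions; `z` is the value of the (single-valued) resolvent at `q`
    ∀ x : ℕ → Fin r → H, SetValuedOp.IsParallelAAMR A γ β lam q x₀ x →
      ∃ z : H,
        SetValuedOp.resolvent ((γ / (2 * (r : ℝ) * (1 - β))) • ∑ i, A i) q = {z} ∧
        (∀ i, Tendsto (fun n => x (n + 1) i - x n i) atTop (𝓝 0)) ∧
        (∃ xs : Fin r → H,
          (∀ i, Tendsto (fun n => toWeakSpace ℝ H (x n i)) atTop (𝓝 (toWeakSpace ℝ H (xs i)))) ∧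
          q + (1 / (r : ℝ)) • ∑ i, xs i = z) ∧
        Tendsto (fun n => q + SetValuedOp.average (x n)) atTop (𝓝 z) := by
  obtain ⟨hβ₀, hβ₁⟩ := hβ
  have hB : ∀ i, SetValuedOp.IsMaximallyMonotone (γ • SetValuedOp.innerPerturb (A i) (-q)) :=
    fun i => (hA i).smul_innerPerturb_neg hγ q
  have hBm := fun i => (hB i).1
  choose J hJ using fun i => (hB i).exists_sub_mem
  set T := SetValuedOp.aamrMap β J
  have hiff := fun x => SetValuedOp.isParallelAAMR_iff (β := β) (lam := lam) (x₀ := x₀) (x := x)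
    hBm hJ
  have hsing : SetValuedOp.IsMonotone ((γ / (2 * (r : ℝ) * (1 - β))) • ∑ i, A i) := by
    refine SetValuedOp.IsMonotone.smul_sum (fun i => (hA i).1) ?_
    have := sub_pos.2 hβ₁
    positivity
  obtain ⟨z, hz⟩ := SetValuedOp.mem_ran_idOp_add.1 hq
  refine ⟨?_, fun x hx => ⟨z, hsing.resolvent_eq_singleton hz, ?_⟩⟩
  · refine ⟨fun n => n.rec x₀ fun k y => (1 - lam k) • y + lam k • (T (WithLp.toLp 2 y)).ofLp,
      (hiff _).2 ⟨rfl, fun n => rfl⟩, fun x hx => ?_⟩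
    obtain ⟨h0, hs⟩ := (hiff x).1 hx
    funext n
    induction n with
    | zero => exact h0
    | succ n ih => rw [hs, ih]
  obtain ⟨-, hs⟩ := (hiff x).1 hx
  set X : ℕ → PiLp 2 fun _ : Fin r => H := fun n => WithLp.toLp 2 (x n)
  have hXs : ∀ n, X (n + 1) = (1 - lam n) • X n + lam n • T (X n) := fun n =>
    congrArg (WithLp.toLp 2) (hs n)
  have hfix : ∀ y, T y = y → q + SetValuedOp.average y.ofLp = z := fun y hy =>
    hsing.eq_of_sub_mem
      (SetValuedOp.sub_mem_of_aamrMap_eq_self hr hγ hβ₀ hβ₁ hJ hy) hz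
  obtain ⟨y₀, hy₀⟩ := SetValuedOp.exists_aamrMap_eq_self hr hγ hβ₀ hβ₁ hBm hJ hz
  obtain ⟨hres, hbdd, y, hy, hweak⟩ := krasnoselskii_mann
    (SetValuedOp.lipschitzWith_aamrMap hr hBm hJ hβ₀.le hβ₁.le) hy₀ hlam hsum hXs
  refine ⟨fun i => ?_, ⟨y.ofLp, fun i => ?_, hfix y hy⟩, ?_⟩
  · refine squeeze_zero_norm (fun n => ?_) hres
    have h1 : x (n + 1) i - x n i = -(lam n • (X n - T (X n)) i) := by
      rw [hs]
      show (1 - lam n) • x n i + lam n • T (X n) i - x n i = -(lam n • (x n i - T (X n) i))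
      module
    rw [h1, norm_neg, norm_smul, Real.norm_of_nonneg (hlam n).1]
    exact (mul_le_of_le_one_left (norm_nonneg _) (hlam n).2).trans (PiLp.norm_apply_le _ i)
  · refine tendsto_toWeakSpace_iff_inner.2 fun v => ?_
    -- The `i`-th coordinate is tested against `v` by the vector supported at `i`.
    have hcoord : ∀ w : PiLp 2 fun _ : Fin r => H,
        ⟪WithLp.toLp 2 (Pi.single i v : Fin r → H), w⟫_ℝ = ⟪v, w i⟫_ℝ := by
      intro w
      rw [PiLp.inner_apply, Finset.sum_eq_single i (fun j _ hj => by simp [hj]) (by simp)]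
      show ⟪(Pi.single i v : Fin r → H) i, w i⟫_ℝ = _
      rw [Pi.single_eq_same]
    have h := hweak (WithLp.toLp 2 (Pi.single i v : Fin r → H))
    simp only [hcoord] at h
    exact h
  · rw [← hfix y₀ hy₀]
    exact (SetValuedOp.tendsto_average_of_tendsto_residual hr hBm hJ hβ₀ hβ₁ hy₀ hbdd
      hres).const_add q
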